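/- Let $n,k,t$ be positive integers. A $k$-partition of $[n]=\{1,\dots,n\}$ is a set of $k$ pairwise disjoint non-empty subsets of $[n]$ (its blocks) whose union is $[n]$. A family of $k$-partitions of $[n]$ is $t$-intersecting if any two of its members have at least $t$ blocks in common, and a $t$-intersecting family of $k$-partitions of $[n]$ is maximal if it is not properly contained in another $t$-intersecting family of $k$-partitions of $[n]$. Let $S(m,r)$ denote the Stirling number of the second kind, i.e. the number of partitions of an $m$-set into $r$ non-empty blocks, and put $$L(k,t)=(t+1)+(k-t+1)\log_2\bigl((t+1)(k-t+1)\bigr).$$ Suppose that $k\ge t+3$ and $n\ge 2L(k,t)$, and let $\mathcal F$ be a maximal $t$-intersecting family of $k$-partitions of $[n]$ with $|\mathcal F|<S(n-t,k-t)$. Then $|\mathcal F|\le S(n-t-1,k-t)$. Moreover, equality holds only if there are a set $A\subseteq[n]$ with $|A|=t-1$ and a set $B\subseteq[n]\setminus A$ with $|B|=2$ such that $\mathcal F$ consists of all $k$-partitions of $[n]$ that have $B$ and all the singletons $\{a\}$, $a\in A$, among their blocks. -/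

import Mathlib

namespace PartitionFamilies

/-- A partition of the standard `n`-set (modelled by `Fin n`) into pairwise disjoint non-empty
blocks whose union is everything. -/
abbrev SetPartition (n : ℕ) : Type := Finpartition (Finset.univ : Finset (Fin n))

/-- The collection of all `k`-partitions of the `n`-set: the partitions with exactly `k` blocks. -/
def kPartitions (n k : ℕ) : Finset (SetPartition n) :=
  Finset.univ.filter fun P => P.parts.card = k

/-- A family of partitions is `t`-intersecting if any two of its members have at least `t` blocks
in common. -/
def IsIntersectingFamily {n : ℕ} (t : ℕ) (F : Finset (SetPartition n)) : Prop :=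
  ∀ P ∈ F, ∀ Q ∈ F, t ≤ (P.parts ∩ Q.parts).card

/-- `F` is a maximal `t`-intersecting family of `k`-partitions: it is a `t`-intersecting family of
`k`-partitions and equals every such family that contains it. -/
def IsMaximalIntersectingFamily {n : ℕ} (k t : ℕ) (F : Finset (SetPartition n)) : Prop :=
  Maximal (fun G : Finset (SetPartition n) => G ⊆ kPartitions n k ∧ IsIntersectingFamily t G) F

/-- `L(k,t) = (t+1) + (k-t+1) * log₂((t+1)(k-t+1))`, with real subtraction. -/
noncomputable def L (k t : ℕ) : ℝ :=
  ((t : ℝ) + 1) + ((k : ℝ) - t + 1) * Real.logb 2 (((t : ℝ) + 1) * ((k : ℝ) - t + 1))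

end PartitionFamilies

/-! Either the members of F share a set Y of t blocks, or they do not. If they do, maximality makes
F the family of all k-partitions containing Y, so |F| = S(n-u, k-t), where u ≥ t is the number of
points covered by Y. The hypothesis excludes u = t, so u ≥ t+1. Equality forces u = t+1, which makes
Y a pair together with t-1 singletons. If they do not, take a smallest set T of blocks meeting every
member in at least t blocks, so |T| > t. Each member contains one of the C(|T|,t) t-subsets of T. As
long as a set X of blocks is smaller than T, some member meets X in fewer than t blocks, and X can
be extended in only k-t+1 ways (`exists_hitting_set`). Each extension costs a factor k-t+1, but for
n ≥ 2L it shrinks the Stirling bound by (t+1)(k-t+1) (`mul_stirlingSecond_succ_le`). What remains is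
strictly below S(n-t-1, k-t) (`mul_stirlingSecond_lt`). -/

namespace PartitionFamilies

/-! ### Estimates for Stirling numbers. -/

section Stirling

open Nat Finset

/-- Counting functions from an `m`-set to an `N`-set by the size of the image. -/
theorem sum_descFactorial_mul_stirlingSecond (N m : ℕ) :
    ∑ j ∈ range (N + 1), N.descFactorial j * stirlingSecond m j = N ^ m := by
  induction m with
  | zero =>
    rw [sum_range_succ']
    simp
  | succ m ih =>
    have h1 : ∑ j ∈ range (N + 1), N.descFactorial j * stirlingSecond (m + 1) j =
        ∑ j ∈ range (N + 1), N.descFactorial j * (j * stirlingSecond m j) +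
          ∑ j ∈ range (N + 1), N.descFactorial (j + 1) * stirlingSecond m j := by
      rw [sum_range_succ', sum_range_succ' (fun j => N.descFactorial j * (j * stirlingSecond m j)),
        sum_range_succ (fun j => N.descFactorial (j + 1) * stirlingSecond m j)]
      simp only [stirlingSecond_succ_succ, mul_add, sum_add_distrib]
      simp
    rw [h1, ← sum_add_distrib, pow_succ', ← ih, mul_sum]
    refine sum_congr rfl fun j hj => ?_
    obtain ⟨d, hd⟩ := Nat.exists_eq_add_of_le (Nat.lt_succ_iff.1 (mem_range.1 hj))
    rw [Nat.descFactorial_succ, hd, Nat.add_sub_cancel_left]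
    ring

theorem factorial_mul_stirlingSecond_le (m r : ℕ) : r ! * stirlingSecond m r ≤ r ^ m := by
  rw [← sum_descFactorial_mul_stirlingSecond r m, ← Nat.descFactorial_self]
  exact single_le_sum (f := fun j => r.descFactorial j * stirlingSecond m j)
    (fun _ _ => Nat.zero_le _) (mem_range.2 (Nat.lt_succ_self r))

/-- A map to r+1 points is surjective or misses one of them. -/
theorem pow_le_factorial_mul_stirlingSecond_add (m r : ℕ) :
    (r + 1) ^ m ≤ (r + 1)! * stirlingSecond m (r + 1) + (r + 1) * r ^ m := by
  rw [← sum_descFactorial_mul_stirlingSecond (r + 1) m, sum_range_succ, Nat.descFactorial_self,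
    add_comm, ← sum_descFactorial_mul_stirlingSecond r m, mul_sum]
  refine Nat.add_le_add_left (sum_le_sum fun j hj => ?_) _
  rw [← mul_assoc]
  refine Nat.mul_le_mul_right _ ?_
  rw [← Nat.succ_descFactorial]
  have := mem_range.1 hj
  exact Nat.le_mul_of_pos_left _ (by omega)

/-- A lower bound for the ratio of consecutive Stirling numbers in a row. -/
theorem mul_stirlingSecond_le_of_pow_le {m r W : ℕ} (h : W * r ^ m ≤ (r + 1) ^ m) :
    W * stirlingSecond m r ≤ (r + 1) * (stirlingSecond m (r + 1) + stirlingSecond m r) := by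
  rcases le_or_gt W (r + 1) with hW | hW
  · exact Nat.mul_le_mul hW (Nat.le_add_left _ _)
  obtain ⟨d, rfl⟩ := Nat.exists_eq_add_of_lt hW
  have h1 := pow_le_factorial_mul_stirlingSecond_add m r
  have h2 := factorial_mul_stirlingSecond_le m r
  have h3 : (d + 1) * r ^ m ≤ (r + 1)! * stirlingSecond m (r + 1) := by nlinarith
  have h4 : r ! * ((d + 1) * stirlingSecond m r) ≤ r ! * ((r + 1) * stirlingSecond m (r + 1)) := by
    calc r ! * ((d + 1) * stirlingSecond m r) = (d + 1) * (r ! * stirlingSecond m r) := by ring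
      _ ≤ (d + 1) * r ^ m := Nat.mul_le_mul_left _ h2
      _ ≤ _ := h3
      _ = _ := by rw [Nat.factorial_succ]; ring
  have h5 := Nat.le_of_mul_le_mul_left h4 (Nat.factorial_pos r)
  nlinarith

theorem pow_le_pow_succ_of_pow_le_two_pow {m r X : ℕ} (hr : r ≠ 0) (h : X ^ (2 * r) ≤ 2 ^ m) :
    X ^ 2 * r ^ m ≤ (r + 1) ^ m := by
  have h1 : 2 * r ^ r ≤ (r + 1) ^ r := by
    have h := one_add_mul_le_pow (R := ℚ) (a := 1 / r) (n := r)
      (by have : (0 : ℚ) ≤ 1 / r := by positivity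
          linarith)
    have hr0 : (r : ℚ) ≠ 0 := by exact_mod_cast hr
    have h2 : (r + 1 : ℚ) ^ r = (1 + 1 / r : ℚ) ^ r * r ^ r := by
      rw [← mul_pow]
      congr 1
      field_simp
    have h3 : (2 : ℚ) ≤ (1 + 1 / r : ℚ) ^ r := by
      refine le_trans (le_of_eq ?_) h
      field_simp
      norm_num
    have h4 : (2 * r ^ r : ℚ) ≤ (r + 1 : ℚ) ^ r := by
      rw [h2]
      exact mul_le_mul_of_nonneg_right h3 (by positivity)
    exact_mod_cast h4
  -- After taking r-th powers, Bernoulli's 2 r^r ≤ (r+1)^r applies m times.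
  refine (Nat.pow_le_pow_iff_left hr).1 ?_
  calc (X ^ 2 * r ^ m) ^ r = X ^ (2 * r) * (r ^ r) ^ m := by
        rw [mul_pow, ← pow_mul, ← pow_mul, ← pow_mul, mul_comm m r]
    _ ≤ 2 ^ m * (r ^ r) ^ m := Nat.mul_le_mul_right _ h
    _ = (2 * r ^ r) ^ m := by rw [mul_pow]
    _ ≤ ((r + 1) ^ r) ^ m := Nat.pow_le_pow_left h1 m
    _ = _ := by rw [← pow_mul, ← pow_mul, mul_comm]

theorem stirlingSecond_pos {m r : ℕ} (hr : 1 ≤ r) (h : r ≤ m) : 0 < stirlingSecond m r := by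
  induction m, h using Nat.le_induction with
  | base => simp [stirlingSecond_self]
  | succ m hm ih =>
    rw [stirlingSecond_succ_left _ _ (by omega)]
    exact Nat.add_pos_left (Nat.mul_pos hr ih) _

theorem stirlingSecond_le_succ {r : ℕ} (hr : 1 ≤ r) (m : ℕ) :
    stirlingSecond m r ≤ stirlingSecond (m + 1) r := by
  rw [stirlingSecond_succ_left _ _ (by omega)]
  exact le_add_right (Nat.le_mul_of_pos_left _ hr)

theorem stirlingSecond_lt_succ {m r : ℕ} (hr : 2 ≤ r) (h : r - 1 ≤ m) :
    stirlingSecond m r < stirlingSecond (m + 1) r := by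
  rw [stirlingSecond_succ_left _ _ (by omega)]
  have := stirlingSecond_pos (m := m) (r := r - 1) (by omega) h
  have := Nat.le_mul_of_pos_left (stirlingSecond m r) (show 0 < r by omega)
  omega

theorem stirlingSecond_mono {r : ℕ} (hr : 1 ≤ r) : Monotone fun m => stirlingSecond m r :=
  monotone_nat_of_le_succ (stirlingSecond_le_succ hr)

/-- Here c plays the complement of the block containing one extra point added to s. -/
theorem sum_powerset_stirlingSecond {α : Type*} [DecidableEq α] (s : Finset α) (k : ℕ) :
    ∑ c ∈ s.powerset, stirlingSecond #c k = stirlingSecond (#s + 1) (k + 1) := by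
  induction s using Finset.induction_on generalizing k with
  | empty => cases k <;> simp [stirlingSecond]
  | insert a s ha ih =>
    rw [sum_powerset_insert ha, ih, card_insert_of_notMem ha,
      stirlingSecond_succ_succ (#s + 1) k]
    have h : ∀ c ∈ s.powerset, #(insert a c) = #c + 1 := fun c hc =>
      card_insert_of_notMem fun h => ha (mem_powerset.1 hc h)
    rw [sum_congr rfl fun c hc => by rw [h c hc]]
    cases k with
    | zero => simp
    | succ k =>
      simp only [stirlingSecond_succ_succ _ k, sum_add_distrib, ← mul_sum, ih]
      ring

end Stirling

/-! ### Consequences of n ≥ 2L. -/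

section Threshold

open Nat

theorem pow_mul_pow_le_of_two_mul_L_le {n k t : ℕ} (hk : t + 3 ≤ k)
    (hn : 2 * L k t ≤ (n : ℝ)) :
    2 ^ (2 * (t + 1)) * ((t + 1) * (k - t + 1)) ^ (2 * (k - t + 1)) ≤ 2 ^ n := by
  obtain ⟨d, rfl⟩ := Nat.exists_eq_add_of_le (show t ≤ k by omega)
  simp only [Nat.add_sub_cancel_left]
  set X := (t + 1) * (d + 1) with hX
  have hXpos : (0 : ℝ) < (X : ℝ) := by
    have : 0 < X := by positivity
    exact_mod_cast this
  have hL : 2 * L (t + d) t = ((2 * (t + 1) : ℕ) : ℝ) + Real.logb 2 X * ((2 * (d + 1) : ℕ) : ℝ) := by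
    have : ((t : ℝ) + 1) * (((t + d : ℕ) : ℝ) - t + 1) = (X : ℝ) := by
      rw [hX]; push_cast; ring
    rw [L, this]; push_cast; ring
  have h := Real.rpow_le_rpow_of_exponent_le (show (1 : ℝ) ≤ 2 by norm_num) (hL ▸ hn)
  rw [Real.rpow_add (by norm_num), Real.rpow_mul (by norm_num),
    Real.rpow_logb (by norm_num) (by norm_num) hXpos, Real.rpow_natCast, Real.rpow_natCast,
    Real.rpow_natCast] at h
  exact_mod_cast h

variable {n k t : ℕ}

theorem le_of_two_mul_L_le (ht : 1 ≤ t) (hk : t + 3 ≤ k) (hn : 2 * L k t ≤ (n : ℝ)) :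
    2 * (t + 1) + 6 * (k - t + 1) ≤ n := by
  have h := pow_mul_pow_le_of_two_mul_L_le hk hn
  have h8 : 2 ^ 3 ≤ (t + 1) * (k - t + 1) :=
    le_trans (by norm_num) (Nat.mul_le_mul (show 2 ≤ t + 1 by omega) (show 4 ≤ k - t + 1 by omega))
  refine (Nat.pow_le_pow_iff_right (show 1 < 2 by norm_num)).1 (le_trans ?_ h)
  rw [pow_add]
  refine Nat.mul_le_mul_left _ (le_trans (le_of_eq ?_) (Nat.pow_le_pow_left h8 _))
  rw [← pow_mul]
  congr 1
  ring

theorem pow_le_two_pow_of_two_mul_L_le (ht : 1 ≤ t) (hk : t + 3 ≤ k)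
    (hn : 2 * L k t ≤ (n : ℝ)) {s : ℕ} (hts : t ≤ s) (hsk : s + 2 ≤ k) :
    ((t + 1) * (k - t + 1)) ^ (2 * (k - s - 1)) ≤ 2 ^ (n - s - 1) := by
  have h := pow_mul_pow_le_of_two_mul_L_le hk hn
  have hle := le_of_two_mul_L_le ht hk hn
  set X := (t + 1) * (k - t + 1) with hX
  have h2 : 2 ≤ X :=
    le_trans (by norm_num) (Nat.mul_le_mul (show 2 ≤ t + 1 by omega) (show 1 ≤ k - t + 1 by omega))
  -- The powers of X not needed for this s pay for replacing n by n-s-1.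
  have h3 : 2 ^ (s + 1) ≤ 2 ^ (2 * (t + 1)) * X ^ (2 * (s - t + 2)) := by
    refine le_trans ?_ (Nat.mul_le_mul_left _ (Nat.pow_le_pow_left h2 _))
    rw [← pow_add]
    exact Nat.pow_le_pow_right (by norm_num) (by omega)
  refine Nat.le_of_mul_le_mul_right ?_ (show 0 < 2 ^ (s + 1) by positivity)
  calc X ^ (2 * (k - s - 1)) * 2 ^ (s + 1)
      ≤ X ^ (2 * (k - s - 1)) * (2 ^ (2 * (t + 1)) * X ^ (2 * (s - t + 2))) :=
        Nat.mul_le_mul_left _ h3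
    _ = 2 ^ (2 * (t + 1)) * X ^ (2 * (k - s - 1) + 2 * (s - t + 2)) := by rw [pow_add]; ring
    _ = 2 ^ (2 * (t + 1)) * X ^ (2 * (k - t + 1)) := by congr 2; omega
    _ ≤ 2 ^ n := h
    _ = _ := by rw [← pow_add]; congr 1; omega

theorem sq_mul_stirlingSecond_le (ht : 1 ≤ t) (hk : t + 3 ≤ k)
    (hn : 2 * L k t ≤ (n : ℝ)) {s : ℕ} (hts : t ≤ s) (hsk : s + 2 ≤ k) :
    ((t + 1) * (k - t + 1)) ^ 2 * stirlingSecond (n - s - 1) (k - s - 1) ≤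
      (k - s) * (stirlingSecond (n - s - 1) (k - s) + stirlingSecond (n - s - 1) (k - s - 1)) := by
  have h := mul_stirlingSecond_le_of_pow_le (pow_le_pow_succ_of_pow_le_two_pow
    (show k - s - 1 ≠ 0 by omega) (pow_le_two_pow_of_two_mul_L_le ht hk hn hts hsk))
  rwa [show k - s - 1 + 1 = k - s by omega] at h

theorem mul_stirlingSecond_succ_le (ht : 1 ≤ t) (hk : t + 3 ≤ k)
    (hn : 2 * L k t ≤ (n : ℝ)) {s : ℕ} (hts : t ≤ s) (hsk : s + 2 ≤ k) :
    ((t + 1) * (k - t + 1)) * stirlingSecond (n - (s + 1)) (k - (s + 1)) ≤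
      stirlingSecond (n - s) (k - s) := by
  have h := sq_mul_stirlingSecond_le ht hk hn hts hsk
  have hle := le_of_two_mul_L_le ht hk hn
  have hrec : stirlingSecond (n - s) (k - s) =
      (k - s) * stirlingSecond (n - s - 1) (k - s) + stirlingSecond (n - s - 1) (k - s - 1) := by
    have := stirlingSecond_succ_left (n - s - 1) (k - s) (by omega)
    rwa [show n - s - 1 + 1 = n - s by omega] at this
  rw [hrec, ← Nat.sub_sub, ← Nat.sub_sub]
  set X := (t + 1) * (k - t + 1) with hX
  have hXk : k - s + 1 ≤ X :=
    le_trans (show k - s + 1 ≤ 1 * (k - t + 1) by omega) (Nat.mul_le_mul_right _ (by omega))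
  generalize stirlingSecond (n - s - 1) (k - s - 1) = a at *
  generalize stirlingSecond (n - s - 1) (k - s) = b at *
  generalize k - s = r at *
  have : (X + r) * a ≤ X ^ 2 * a := Nat.mul_le_mul_right _ (by nlinarith)
  nlinarith

/-- The left side is the final bound for families without t common blocks. The squared factor in
`sq_mul_stirlingSecond_le` is what makes room for the extra t+1. -/
theorem mul_stirlingSecond_lt (ht : 1 ≤ t) (hk : t + 3 ≤ k) (hn : 2 * L k t ≤ (n : ℝ)) :
    (t + 1) * ((t + 1) * (k - t + 1)) * stirlingSecond (n - (t + 1)) (k - (t + 1)) <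
      stirlingSecond (n - t - 1) (k - t) := by
  have h := sq_mul_stirlingSecond_le ht hk hn le_rfl (by omega)
  have hle := le_of_two_mul_L_le ht hk hn
  have hpos : 0 < stirlingSecond (n - t - 1) (k - t - 1) := stirlingSecond_pos (by omega) (by omega)
  rw [← Nat.sub_sub, ← Nat.sub_sub]
  by_contra! hcon
  generalize stirlingSecond (n - t - 1) (k - t - 1) = a at *
  generalize stirlingSecond (n - t - 1) (k - t) = b at *
  generalize k - t = r at *
  have h1 : ((t + 1) * (r + 1)) ^ 2 * a ≤ (r * ((t + 1) * ((t + 1) * (r + 1)) + 1)) * a := by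
    refine h.trans ?_
    rw [mul_assoc r]
    exact Nat.mul_le_mul_left _ (by rw [add_mul, one_mul]; exact Nat.add_le_add_right hcon _)
  have h2 := Nat.le_of_mul_le_mul_right h1 hpos
  nlinarith [sq_nonneg t]

end Threshold

/-! ### Counting partitions with prescribed blocks. -/

section Counting

open Finset

variable {α : Type*} [DecidableEq α]

/-- Removing from a partition a subfamily of its blocks. -/
def removeBlocks {u : Finset α} (Q : Finpartition u) {Y : Finset (Finset α)} (h : Y ⊆ Q.parts) :
    Finpartition (u \ Y.sup id) where
  parts := Q.parts \ Y
  supIndep := Q.supIndep.subset sdiff_subset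
  sup_parts := by
    ext x
    simp only [mem_sup, mem_sdiff, id]
    constructor
    · rintro ⟨b, ⟨hb, hbY⟩, hx⟩
      refine ⟨Q.le hb hx, ?_⟩
      rintro ⟨c, hc, hxc⟩
      exact hbY (Q.eq_of_mem_parts hb (h hc) hx hxc ▸ hc)
    · rintro ⟨hx, hY⟩
      obtain ⟨b, hb, hxb⟩ := Q.exists_mem hx
      exact ⟨b, ⟨hb, fun hbY => hY ⟨b, hbY, hxb⟩⟩, hxb⟩
  bot_notMem hb := Q.bot_notMem (mem_sdiff.1 hb).1

/-- Adding pairwise disjoint blocks to a partition of the complement of their union. -/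
def addBlocks {u : Finset α} {Y : Finset (Finset α)} (hd : (Y : Set (Finset α)).PairwiseDisjoint id)
    (h0 : ∅ ∉ Y) (hu : Y.sup id ⊆ u) (R : Finpartition (u \ Y.sup id)) : Finpartition u where
  parts := R.parts ∪ Y
  supIndep := by
    rw [supIndep_iff_pairwiseDisjoint, coe_union, Set.pairwiseDisjoint_union]
    refine ⟨R.disjoint, hd, fun b hb c hc _ => ?_⟩
    exact disjoint_of_subset_left (R.le hb)
      (disjoint_of_subset_right (le_sup (f := id) hc) sdiff_disjoint)
  sup_parts := by
    rw [sup_union, R.sup_parts]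
    exact sdiff_union_of_subset hu
  bot_notMem hb := (mem_union.1 hb).elim R.bot_notMem h0

theorem disjoint_parts_of_finpartition_sdiff {u : Finset α} {Y : Finset (Finset α)}
    (R : Finpartition (u \ Y.sup id)) : Disjoint R.parts Y := by
  rw [Finset.disjoint_left]
  intro b hb hbY
  obtain ⟨x, hx⟩ := R.nonempty_of_mem_parts hb
  exact (mem_sdiff.1 (R.le hb hx)).2 (mem_sup.2 ⟨b, hbY, hx⟩)

theorem card_filter_subset_parts {u : Finset α} {Y : Finset (Finset α)}
    (hd : (Y : Set (Finset α)).PairwiseDisjoint id) (h0 : ∅ ∉ Y) (hu : Y.sup id ⊆ u) {k : ℕ}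
    (hk : #Y ≤ k) :
    #{Q : Finpartition u | #Q.parts = k ∧ Y ⊆ Q.parts} =
      #{R : Finpartition (u \ Y.sup id) | #R.parts = k - #Y} := by
  refine card_bij' (fun Q hQ => removeBlocks Q (mem_filter.1 hQ).2.2)
    (fun R _ => addBlocks hd h0 hu R) ?_ ?_ ?_ ?_
  · intro Q hQ
    have hQ' := (mem_filter.1 hQ).2
    simp [removeBlocks, card_sdiff_of_subset hQ'.2, hQ'.1]
  · intro R hR
    have hR' := (mem_filter.1 hR).2
    simp only [mem_filter, mem_univ, true_and, addBlocks]
    refine ⟨?_, subset_union_right⟩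
    rw [card_union_of_disjoint (disjoint_parts_of_finpartition_sdiff R), hR']
    omega
  · intro Q hQ
    ext1
    exact sdiff_union_of_subset (mem_filter.1 hQ).2.2
  · intro R hR
    ext1
    exact union_sdiff_cancel_right (disjoint_parts_of_finpartition_sdiff R)

theorem card_finpartition_filter_card_parts (u : Finset α) (k : ℕ) :
    #{Q : Finpartition u | #Q.parts = k} = Nat.stirlingSecond #u k := by
  induction u using Finset.strongInduction generalizing k with
  | H u ih =>
    rcases u.eq_empty_or_nonempty with rfl | ⟨a, ha⟩
    · have : ∀ Q : Finpartition (∅ : Finset α), #Q.parts = 0 := fun Q => by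
        rw [card_eq_zero]; exact Q.parts_eq_empty_iff.2 rfl
      cases k with
      | zero =>
        simp only [this, filter_true, card_empty, Nat.stirlingSecond_zero]
        exact Fintype.card_unique (α := Finpartition (⊥ : Finset α))
      | succ k => simp [this]
    cases k with
    | zero =>
      obtain ⟨m, hm⟩ := Nat.exists_eq_succ_of_ne_zero (card_ne_zero_of_mem ha)
      rw [hm, Nat.stirlingSecond_succ_zero, card_eq_zero, filter_eq_empty_iff]
      intro Q _ h
      obtain ⟨b, hb, -⟩ := Q.exists_mem ha
      exact card_ne_zero_of_mem hb h
    | succ k =>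
      have hcard : #(u.erase a) + 1 = #u := card_erase_add_one ha
      rw [← hcard, ← sum_powerset_stirlingSecond]
      -- Fibre over the complement c of the block of a; the rest of Q is a k-partition of c.
      rw [card_eq_sum_card_fiberwise (f := fun Q : Finpartition u => u \ Q.part a)
        (t := (u.erase a).powerset)]
      · refine sum_congr rfl fun c hc => ?_
        have hcu : c ⊆ u := (mem_powerset.1 hc).trans (erase_subset _ _)
        have hac : a ∉ c := fun h => notMem_erase a u (mem_powerset.1 hc h)
        have hsd : u \ (u \ c) = c := by rw [sdiff_sdiff_right_self]; exact inf_eq_right.2 hcu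
        have hlt : c ⊂ u := (ssubset_iff_of_subset hcu).2 ⟨a, ha, hac⟩
        have h := card_filter_subset_parts (u := u) (Y := {u \ c}) (k := k + 1)
          (by simp) (by
            rw [mem_singleton]
            exact fun h => (h ▸ notMem_empty a : a ∉ u \ c) (mem_sdiff.2 ⟨ha, hac⟩))
          (by simp) (by simp)
        rw [sup_singleton, id, hsd, card_singleton, Nat.add_sub_cancel, ih c hlt k] at h
        rw [← h, filter_filter]
        congr 1
        ext Q
        simp only [mem_filter, mem_univ, true_and, singleton_subset_iff, and_congr_right_iff]
        intro _
        constructor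
        · rintro rfl
          rw [sdiff_sdiff_right_self, inf_eq_right.2 (Q.part_subset a)]
          exact Q.part_mem.2 ha
        · intro hQ
          rw [Q.part_eq_of_mem hQ (mem_sdiff.2 ⟨ha, hac⟩), hsd]
      · intro Q _
        simp only [coe_powerset, Set.mem_preimage, Set.mem_powerset_iff, coe_subset]
        intro x hx
        have hx' := mem_sdiff.1 hx
        refine mem_erase.2 ⟨?_, hx'.1⟩
        rintro rfl
        exact hx'.2 (Q.mem_part_self.2 ha)

theorem card_le_card_sup {Y : Finset (Finset α)} (hd : (Y : Set (Finset α)).PairwiseDisjoint id)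
    (h0 : ∅ ∉ Y) : #Y ≤ #(Y.sup id) := by
  rw [sup_eq_biUnion, card_biUnion fun x hx y hy hxy => hd hx hy hxy, card_eq_sum_ones]
  exact sum_le_sum fun b hb => card_pos.2 (nonempty_iff_ne_empty.2 fun h => h0 (h ▸ hb))

variable {n : ℕ}

theorem card_kPartitions_filter_superset {Q : SetPartition n} {k : ℕ}
    {Y : Finset (Finset (Fin n))} (hY : Y ⊆ Q.parts) (hk : #Y ≤ k) :
    #{P ∈ kPartitions n k | Y ⊆ P.parts} =
      Nat.stirlingSecond (n - #(Y.sup id)) (k - #Y) := by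
  have hd : (Y : Set (Finset (Fin n))).PairwiseDisjoint id := Q.disjoint.subset (coe_subset.2 hY)
  have h := card_filter_subset_parts (k := k) hd (fun h => Q.bot_notMem (hY h)) (subset_univ _) hk
  rw [card_finpartition_filter_card_parts, card_sdiff_of_subset (subset_univ _), card_univ,
    Fintype.card_fin] at h
  rw [← h, kPartitions, filter_filter]

theorem card_kPartitions_filter_superset_le {k : ℕ} (Y : Finset (Finset (Fin n))) (hk : #Y < k) :
    #{P ∈ kPartitions n k | Y ⊆ P.parts} ≤ Nat.stirlingSecond (n - #Y) (k - #Y) := by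
  rcases ({P ∈ kPartitions n k | Y ⊆ P.parts}).eq_empty_or_nonempty with h | ⟨Q, hQ⟩
  · simp [h]
  have hY := (mem_filter.1 hQ).2
  rw [card_kPartitions_filter_superset hY hk.le]
  have hd : (Y : Set (Finset (Fin n))).PairwiseDisjoint id := Q.disjoint.subset (coe_subset.2 hY)
  exact stirlingSecond_mono (by omega)
    (Nat.sub_le_sub_left (card_le_card_sup hd fun h => Q.bot_notMem (hY h)) n)

end Counting

/-! ### Branching on hitting sets. -/

section Branching

open Finset

variable {ι β : Type*} [DecidableEq β] {F : Finset ι} {S : ι → Finset β} {k t : ℕ}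

/-- If some member of a `t`-intersecting family of `k`-sets meets `X` in fewer than `t` elements,
then the members containing `X` are hit by a set of at most `k - t + 1` elements outside `X`. -/
theorem exists_hitting_set (hS : ∀ i ∈ F, #(S i) = k) (hF : ∀ i ∈ F, ∀ j ∈ F, t ≤ #(S i ∩ S j))
    {X : Finset β} {q : ι} (hq : q ∈ F) (hX : #(X ∩ S q) < t) :
    ∃ Z : Finset β, #Z ≤ k - t + 1 ∧ Disjoint Z X ∧
      ∀ i ∈ F, X ⊆ S i → ∃ z ∈ Z, z ∈ S i := by
  have hkt : t ≤ k := by simpa [hS q hq] using hF q hq q hq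
  have hsplit : #(S q \ X) + #(X ∩ S q) = k := by
    rw [inter_comm, card_sdiff_add_card_inter, hS q hq]
  -- A member avoiding Z would meet `S q` in at most k - (k-t+1) = t-1 elements.
  obtain ⟨Z, hZ, hZc⟩ := exists_subset_card_eq (s := S q \ X) (n := k - t + 1) (by omega)
  refine ⟨Z, hZc.le, disjoint_of_subset_left hZ sdiff_disjoint, fun i hi _ => ?_⟩
  by_contra! hcon
  have h1 : S i ∩ S q ⊆ (X ∩ S q) ∪ ((S q \ X) \ Z) := by
    intro x hx
    have hx' := mem_inter.1 hx
    by_cases hxX : x ∈ X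
    · exact mem_union_left _ (mem_inter.2 ⟨hxX, hx'.2⟩)
    · exact mem_union_right _ (mem_sdiff.2
        ⟨mem_sdiff.2 ⟨hx'.2, hxX⟩, fun hxZ => hcon x hxZ hx'.1⟩)
  have h2 := (hF i hi q hq).trans ((card_le_card h1).trans (card_union_le _ _))
  rw [card_sdiff_of_subset hZ, hZc] at h2
  omega

theorem card_filter_superset_le_of_branching (hS : ∀ i ∈ F, #(S i) = k)
    (hF : ∀ i ∈ F, ∀ j ∈ F, t ≤ #(S i ∩ S j)) {σ c : ℕ}
    (hσ : ∀ X : Finset β, #X < σ → ∃ q ∈ F, #(X ∩ S q) < t)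
    (hc : ∀ X : Finset β, #X = σ → #{i ∈ F | X ⊆ S i} ≤ c) (j : ℕ) (X : Finset β)
    (hX : #X + j = σ) : #{i ∈ F | X ⊆ S i} ≤ (k - t + 1) ^ j * c := by
  classical
  induction j generalizing X with
  | zero => simpa using hc X hX
  | succ j ih =>
    obtain ⟨q, hq, hqX⟩ := hσ X (by omega)
    obtain ⟨Z, hZ, hZX, hhit⟩ := exists_hitting_set hS hF hq hqX
    have hsub : {i ∈ F | X ⊆ S i} ⊆ Z.biUnion fun z => {i ∈ F | insert z X ⊆ S i} := by
      intro i hi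
      obtain ⟨hiF, hiX⟩ := mem_filter.1 hi
      obtain ⟨z, hz, hzi⟩ := hhit i hiF hiX
      exact mem_biUnion.2 ⟨z, hz, mem_filter.2 ⟨hiF, insert_subset hzi hiX⟩⟩
    calc #{i ∈ F | X ⊆ S i} ≤ #Z * ((k - t + 1) ^ j * c) :=
          (card_le_card hsub).trans (card_biUnion_le_card_mul _ _ _ fun z hz => ih _ (by
            rw [card_insert_of_notMem (Finset.disjoint_left.1 hZX hz)]; omega))
      _ ≤ (k - t + 1) * ((k - t + 1) ^ j * c) := Nat.mul_le_mul_right _ hZ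
      _ = _ := by ring

/-- A bound for a family through a set `T` that meets every member in at least `t` elements. -/
theorem card_le_choose_mul_pow_mul (hS : ∀ i ∈ F, #(S i) = k)
    (hF : ∀ i ∈ F, ∀ j ∈ F, t ≤ #(S i ∩ S j)) {σ c : ℕ} (htσ : t ≤ σ)
    (hσ : ∀ X : Finset β, #X < σ → ∃ q ∈ F, #(X ∩ S q) < t)
    (hc : ∀ X : Finset β, #X = σ → #{i ∈ F | X ⊆ S i} ≤ c) {T : Finset β}
    (hT : ∀ i ∈ F, t ≤ #(T ∩ S i)) :
    #F ≤ (#T).choose t * ((k - t + 1) ^ (σ - t) * c) := by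
  classical
  have hsub : F ⊆ (T.powersetCard t).biUnion fun X => {i ∈ F | X ⊆ S i} := by
    intro i hi
    obtain ⟨X, hX, hXc⟩ := exists_subset_card_eq (hT i hi)
    exact mem_biUnion.2 ⟨X, mem_powersetCard.2 ⟨hX.trans inter_subset_left, hXc⟩,
      mem_filter.2 ⟨hi, hX.trans inter_subset_right⟩⟩
  rw [← card_powersetCard]
  refine (card_le_card hsub).trans (card_biUnion_le_card_mul _ _ _ fun X hX => ?_)
  have hXc := (mem_powersetCard.1 hX).2
  exact card_filter_superset_le_of_branching hS hF hσ hc _ _ (by omega)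

/-- Consecutive ratios (t+j+1)/(j+1) are at most t+1. -/
theorem choose_add_le_pow (t j : ℕ) : (t + j).choose t ≤ (t + 1) ^ j := by
  induction j with
  | zero => simp
  | succ j ih =>
    have h := Nat.choose_mul_succ_eq (t + j) t
    rw [show t + j + 1 - t = j + 1 by omega] at h
    refine Nat.le_of_mul_le_mul_right ?_ (Nat.succ_pos j)
    rw [← add_assoc, ← h, pow_succ, mul_assoc]
    exact Nat.mul_le_mul ih (by nlinarith)

end Branching

/-! ### Families without t common blocks. -/

section Nontrivial

open Finset

variable {n k t : ℕ}

theorem pow_mul_stirlingSecond_le (ht : 1 ≤ t) (hk : t + 3 ≤ k) (hn : 2 * L k t ≤ (n : ℝ)) (j : ℕ)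
    (hj : t + 1 + j < k) :
    ((t + 1) * (k - t + 1)) ^ j * Nat.stirlingSecond (n - (t + 1 + j)) (k - (t + 1 + j)) ≤
      Nat.stirlingSecond (n - (t + 1)) (k - (t + 1)) := by
  induction j with
  | zero => simp
  | succ j ih =>
    refine le_trans ?_ (ih (by omega))
    rw [pow_succ, mul_assoc]
    exact Nat.mul_le_mul_left _
      (mul_stirlingSecond_succ_le ht hk hn (s := t + 1 + j) (by omega) (by omega))

/-- A `t`-intersecting family of `k`-partitions without `t` blocks common to all members is
small. -/
theorem card_lt_of_forall_exists_not_subset (ht : 1 ≤ t) (hk : t + 3 ≤ k)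
    (hn : 2 * L k t ≤ (n : ℝ)) {F : Finset (SetPartition n)} (hFk : F ⊆ kPartitions n k)
    (hF : IsIntersectingFamily t F)
    (hnt : ∀ Y : Finset (Finset (Fin n)), #Y = t → ∃ Q ∈ F, ¬ Y ⊆ Q.parts) :
    #F < Nat.stirlingSecond (n - t - 1) (k - t) := by
  classical
  refine lt_of_le_of_lt ?_ (mul_stirlingSecond_lt ht hk hn)
  rcases F.eq_empty_or_nonempty with rfl | ⟨P, hP⟩
  · simp
  have hS : ∀ Q ∈ F, #Q.parts = k := fun Q hQ => (mem_filter.1 (hFk hQ)).2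
  have hex : ∃ m, ∃ T : Finset (Finset (Fin n)), #T = m ∧ ∀ Q ∈ F, t ≤ #(T ∩ Q.parts) :=
    ⟨k, P.parts, hS P hP, hF P hP⟩
  have hmin := fun m => Nat.find_min (m := m) hex
  have hle : Nat.find hex ≤ k := Nat.find_min' hex ⟨P.parts, hS P hP, hF P hP⟩
  obtain ⟨T, hTc, hT⟩ := Nat.find_spec hex
  have htT : t + 1 ≤ #T := by
    by_contra! hlt
    have h1 : ∀ Q ∈ F, T ⊆ Q.parts ∧ #T = t := fun Q hQ => by
      have h := hT Q hQ
      have h' : #(T ∩ Q.parts) ≤ #T := card_le_card inter_subset_left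
      have heq : T ∩ Q.parts = T := eq_of_subset_of_card_le inter_subset_left (by omega)
      exact ⟨inter_eq_left.1 heq, by omega⟩
    obtain ⟨Q, hQ, hQT⟩ := hnt T (h1 P hP).2
    exact hQT (h1 Q hQ).1
  rw [← hTc] at hle hmin
  -- Branching stops at size k-1 even if |T| = k, since the Stirling bound needs a block left over.
  -- Hence |T| may be t+j+2, one more than the final size.
  obtain ⟨j, hj⟩ := Nat.exists_eq_add_of_le (show t + 1 ≤ min #T (k - 1) by omega)
  have hmain := card_le_choose_mul_pow_mul (F := F) (S := fun Q => Q.parts) (k := k) (t := t)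
    (σ := t + 1 + j) (c := Nat.stirlingSecond (n - (t + 1 + j)) (k - (t + 1 + j)))
    hS hF (by omega) (fun X hX => by
      have h := hmin #X (by omega)
      by_contra! hcon
      exact h ⟨X, rfl, hcon⟩)
    (fun X hX => by
      refine (card_le_card (filter_subset_filter _ hFk)).trans ?_
      rw [← hX]
      exact card_kPartitions_filter_superset_le X (by omega)) hT
  have hchoose : (#T).choose t ≤ (t + 1) ^ (j + 2) :=
    (Nat.choose_le_choose t (show #T ≤ t + (j + 2) by omega)).trans (choose_add_le_pow t (j + 2))
  have hpow := pow_mul_stirlingSecond_le ht hk hn j (by omega)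
  rw [show t + 1 + j - t = j + 1 by omega] at hmain
  refine hmain.trans ((Nat.mul_le_mul_right _ hchoose).trans ?_)
  refine le_trans (le_of_eq ?_) (Nat.mul_le_mul_left _ hpow)
  rw [mul_pow]
  ring

end Nontrivial

/-! ### Families with t common blocks. -/

section Trivial

open Finset

variable {n k t : ℕ}

theorem eq_filter_superset_of_maximal {F : Finset (SetPartition n)}
    (hF : IsMaximalIntersectingFamily k t F) {Y : Finset (Finset (Fin n))} (hY : #Y = t)
    (hYF : ∀ Q ∈ F, Y ⊆ Q.parts) : F = {P ∈ kPartitions n k | Y ⊆ P.parts} := by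
  refine Maximal.eq_of_le hF ⟨filter_subset _ _, fun P hP Q hQ => ?_⟩ fun Q hQ =>
    mem_filter.2 ⟨hF.prop.1 hQ, hYF Q hQ⟩
  rw [← hY]
  exact card_le_card (subset_inter (mem_filter.1 hP).2 (mem_filter.1 hQ).2)

/-- `t` disjoint non-empty blocks covering `t + 1` points are a pair and `t - 1` singletons. -/
theorem exists_singletons_and_pair {α : Type*} [DecidableEq α] {Y : Finset (Finset α)}
    (hd : (Y : Set (Finset α)).PairwiseDisjoint id) (h0 : ∅ ∉ Y) (hY : #(Y.sup id) = #Y + 1) :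
    ∃ A B : Finset α, #A = #Y - 1 ∧ #B = 2 ∧ Disjoint A B ∧
      Y = insert B (A.image fun a => {a}) := by
  have hsum : ∑ b ∈ Y, #b = #Y + 1 := by
    rw [← hY, sup_eq_biUnion, card_biUnion fun x hx y hy hxy => hd hx hy hxy]
    rfl
  have hpos : ∀ b ∈ Y, 1 ≤ #b := fun b hb =>
    card_pos.2 (nonempty_iff_ne_empty.2 fun h => h0 (h ▸ hb))
  obtain ⟨B, hB, hB1⟩ : ∃ B ∈ Y, 1 < #B := by
    by_contra! hcon
    have := sum_le_sum hcon
    rw [hsum, ← card_eq_sum_ones] at this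
    omega
  have hcard := card_erase_add_one hB
  have hle : ∑ b ∈ Y.erase B, 1 ≤ ∑ b ∈ Y.erase B, #b :=
    sum_le_sum fun b hb => hpos b (mem_of_mem_erase hb)
  have hsplit := add_sum_erase Y (fun b => #b) hB
  rw [hsum] at hsplit
  have hones : ∑ b ∈ Y.erase B, 1 = #(Y.erase B) := (card_eq_sum_ones _).symm
  have hone : ∀ b ∈ Y.erase B, #b = 1 := by
    have h := (sum_eq_sum_iff_of_le fun b hb => hpos b (mem_of_mem_erase hb)).1
      (show ∑ b ∈ Y.erase B, 1 = ∑ b ∈ Y.erase B, #b by omega)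
    exact fun b hb => (h b hb).symm
  have himg : Y.erase B = ((Y.erase B).sup id).image fun a => {a} := by
    ext b
    simp only [mem_image, mem_sup, id]
    constructor
    · intro hb
      obtain ⟨a, rfl⟩ := card_eq_one.1 (hone b hb)
      exact ⟨a, ⟨_, hb, mem_singleton_self a⟩, rfl⟩
    · rintro ⟨a, ⟨c, hc, hac⟩, rfl⟩
      obtain ⟨a', rfl⟩ := card_eq_one.1 (hone c hc)
      rwa [mem_singleton.1 hac]
  refine ⟨(Y.erase B).sup id, B, ?_, by omega, ?_, ?_⟩
  · rw [← card_erase_of_mem hB]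
    conv_rhs => rw [himg]
    exact (card_image_of_injective _ singleton_injective).symm
  · rw [Finset.disjoint_sup_left]
    exact fun b hb => hd (mem_of_mem_erase hb) hB (ne_of_mem_erase hb)
  · rw [← himg, insert_erase hB]

end Trivial
end PartitionFamilies

/-! ### The main theorem. -/

open PartitionFamilies Finset in
theorem mainTheorem4 (n k t : ℕ) (ht : 1 ≤ t) (hk : t + 3 ≤ k)
    (hn : 2 * PartitionFamilies.L k t ≤ (n : ℝ))
    (F : Finset (PartitionFamilies.SetPartition n))
    (hF : PartitionFamilies.IsMaximalIntersectingFamily k t F)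
    (hcard : F.card < Nat.stirlingSecond (n - t) (k - t)) :
    F.card ≤ Nat.stirlingSecond (n - t - 1) (k - t) ∧
      (F.card = Nat.stirlingSecond (n - t - 1) (k - t) →
        ∃ A B : Finset (Fin n), A.card = t - 1 ∧ B.card = 2 ∧ Disjoint A B ∧
          F = (PartitionFamilies.kPartitions n k).filter
            (fun P => (∀ a ∈ A, {a} ∈ P.parts) ∧ B ∈ P.parts)) := by
  have hle := le_of_two_mul_L_le ht hk hn
  by_cases hnt : ∀ Y : Finset (Finset (Fin n)), #Y = t → ∃ Q ∈ F, ¬ Y ⊆ Q.parts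
  · have h := card_lt_of_forall_exists_not_subset ht hk hn hF.prop.1 hF.prop.2 hnt
    exact ⟨h.le, fun heq => absurd heq h.ne⟩
  push Not at hnt
  obtain ⟨Y, hYt, hYF⟩ := hnt
  have hFeq := eq_filter_superset_of_maximal hF hYt hYF
  rcases F.eq_empty_or_nonempty with rfl | ⟨P, hP⟩
  · refine ⟨Nat.zero_le _, fun h => ?_⟩
    have := stirlingSecond_pos (m := n - t - 1) (r := k - t) (by omega) (by omega)
    rw [← h, card_empty] at this
    exact absurd this (lt_irrefl 0)
  have hYP := hYF P hP
  have hFcard : #F = Nat.stirlingSecond (n - #(Y.sup id)) (k - t) := by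
    conv_lhs => rw [hFeq]
    rw [card_kPartitions_filter_superset hYP (by omega), hYt]
  have hd : (Y : Set (Finset (Fin n))).PairwiseDisjoint id := P.disjoint.subset (coe_subset.2 hYP)
  have h0 : ∅ ∉ Y := fun h => P.bot_notMem (hYP h)
  have hYsup := card_le_card_sup hd h0
  have hmono := stirlingSecond_mono (r := k - t) (by omega)
  have hlt : t < #(Y.sup id) := by
    rcases (hYt ▸ hYsup).lt_or_eq with h | h
    · exact h
    · rw [hFcard, ← h] at hcard
      exact absurd hcard (lt_irrefl _)
  refine ⟨hFcard ▸ hmono (show n - #(Y.sup id) ≤ n - t - 1 by omega), fun heq => ?_⟩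
  have hsup : #(Y.sup id) = #Y + 1 := by
    by_contra hne
    have h1 : Nat.stirlingSecond (n - #(Y.sup id)) (k - t) ≤
        Nat.stirlingSecond (n - t - 2) (k - t) := hmono (by omega)
    -- Covering t+2 or more points would make the count strictly smaller, as k-t ≥ 2.
    have h2 := stirlingSecond_lt_succ (m := n - t - 2) (r := k - t) (by omega) (by omega)
    rw [show n - t - 2 + 1 = n - t - 1 by omega] at h2
    omega
  obtain ⟨A, B, hA, hB, hAB, hYAB⟩ := exists_singletons_and_pair hd h0 hsup
  refine ⟨A, B, hYt ▸ hA, hB, hAB, ?_⟩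
  rw [hFeq, hYAB]
  refine filter_congr fun Q _ => ?_
  rw [insert_subset_iff, image_subset_iff, and_comm]
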